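/- All manifolds and Lie groups are smooth, without boundary, and modelled on real normed spaces (finite-dimensional ones included). Let $1\to\mathbb{T}\to\widehat\Gamma\xrightarrow{q}\Gamma\to1$ be a central extension of a Lie group $\Gamma$ by the unit circle $\mathbb{T}$, where $q$ is a smooth principal $\mathbb{T}$-bundle, and let $0\to i\mathbb{R}\to\mathrm{Lie}\,\widehat\Gamma\xrightarrow{q_*}\mathrm{Lie}\,\Gamma\to0$ be the induced extension of Lie algebras; elements of $\ker q_*$ are identified with elements of $i\mathbb{R}$. For $\gamma\in\Gamma$ let $\mathrm{Ad}_\gamma$ also denote the action on $\mathrm{Lie}\,\widehat\Gamma$ given by $\mathrm{Ad}_{\hat\gamma}$ for any $\hat\gamma\in\widehat\Gamma$ with $q(\hat\gamma)=\gamma$. A split is a (continuous) linear map $\sigma:\mathrm{Lie}\,\Gamma\to\mathrm{Lie}\,\widehat\Gamma$ with $q_*\circ\sigma=\mathrm{id}$. For a split $\sigma$ put $$Z_\sigma(\gamma,Y)=\mathrm{Ad}_\gamma\sigma(Y)-\sigma(\mathrm{Ad}_\gamma Y)\in i\mathbb{R}\quad(\gamma\in\Gamma,\ Y\in\mathrm{Lie}\,\Gamma),\qquad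 \nu_\sigma=\hat\mu-\sigma(q^*\mu),$$ where $\hat\mu$ and $\mu$ are the left-invariant Maurer-Cartan forms of $\widehat\Gamma$ and $\Gamma$; $\nu_\sigma$ is an $i\mathbb{R}$-valued 1-form on $\widehat\Gamma$. Let $\pi:B\to X$ be a smooth principal $\Gamma$-bundle with a connection $\theta\in\Omega^1(B;\mathrm{Lie}\,\Gamma)$. Let $B^{[2]}=\{(b_1,b_2)\in B\times B\mid\pi(b_1)=\pi(b_2)\}$, with projections $\pi_1,\pi_2:B^{[2]}\to B$, $\pi_i(b_1,b_2)=b_i$, and let $\zeta:B^{[2]}\to\Gamma$ be defined by $b_1\,\zeta(b_1,b_2)=b_2$. Let $\rho:J_B=\zeta^*\widehat\Gamma\to B^{[2]}$ be the pull-back of the $\mathbb{T}$-bundle $q$ along $\zeta$ (the lifting bundle gerbe of $B$), and write $\zeta:J_B\to\widehat\Gamma$ also for the bundle map covering $\zeta$. For a split $\sigma$ define the $i\mathbb{R}$-valued 1-form $$\nabla_{\theta,\sigma}=\zeta^*\nu_\sigma+\rho^*Z_\sigma(\zeta^{-1},\pi_1^*\theta)$$ on $J_B$. **Proposition.** For any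 two splits $\sigma,\sigma'$, $$\nabla_{\theta,\sigma'}-\nabla_{\theta,\sigma}=\rho^*(\pi_1^*-\pi_2^*)\bigl((\sigma'-\sigma)(\theta)\bigr),$$ where $\sigma'-\sigma$ is regarded as a linear map $\mathrm{Lie}\,\Gamma\to i\mathbb{R}$. -/

import Mathlib

open scoped Manifold ContDiff

noncomputable section

namespace LiftingGerbe

/-! ### Differential 1-forms -/

section Forms

variable {E : Type*} [NormedAddCommGroup E] [NormedSpace ℝ E]
  {H : Type*} [TopologicalSpace H] (I : ModelWithCorners ℝ E H)
  (M : Type*) [TopologicalSpace M] [ChartedSpace H M]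
  {E' : Type*} [NormedAddCommGroup E'] [NormedSpace ℝ E']
  {H' : Type*} [TopologicalSpace H'] (I' : ModelWithCorners ℝ E' H')
  {M' : Type*} [TopologicalSpace M'] [ChartedSpace H' M']
  (V : Type*) [AddCommGroup V] [Module ℝ V] [TopologicalSpace V]

/-- `V`-valued 1-forms on `M`, as families of continuous linear maps on the tangent spaces.
Addition and subtraction are pointwise. -/
abbrev OneForm : Type _ := ∀ x : M, TangentSpace I x →L[ℝ] V

variable {M V}

/-- The pull-back `f^*η` of a 1-form. -/
def OneForm.pullback (f : M' → M) (η : OneForm I M V) : OneForm I' M' V :=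
  fun x => (η (f x)).comp (mfderiv I' I f x)

/-- The imaginary line `iℝ ⊆ ℂ`, the Lie algebra of the unit circle. -/
abbrev ImagLine : Submodule ℝ ℂ := LinearMap.ker Complex.reLm

/-- The manifold structure on `M'` for which the homeomorphism `e : M' ≃ₜ M` is a
diffeomorphism: its charts are the charts of `M` precomposed with `e`. -/
@[reducible]
def transportChartedSpace (e : M' ≃ₜ M) : ChartedSpace H M' where
  atlas := {c | ∃ c' ∈ atlas H M, c = e.toOpenPartialHomeomorph.trans c'}
  chartAt x := e.toOpenPartialHomeomorph.trans (chartAt H (e x))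
  mem_chart_source x := by simp
  chart_mem_atlas x := ⟨_, chart_mem_atlas H (e x), rfl⟩

theorem isManifold_transport (n : ℕ∞ω) [hM : IsManifold I n M] (e : M' ≃ₜ M) :
    let _ := transportChartedSpace (H := H) e
    IsManifold I n M' := by
  let _ := transportChartedSpace (H := H) e
  have : HasGroupoid M' (contDiffGroupoid n I) := by
    refine ⟨?_⟩
    rintro _ _ ⟨c, hc, rfl⟩ ⟨c', hc', rfl⟩
    have h := hM.compatible hc hc'
    refine (contDiffGroupoid n I).mem_of_eqOnSource h ?_
    refine ⟨by ext x; simp, fun x _ => by simp⟩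
  exact IsManifold.mk' I n M'

theorem contMDiff_transport (n : ℕ∞ω) [IsManifold I n M] (e : M' ≃ₜ M) :
    let _ := transportChartedSpace (H := H) e
    ContMDiff I I n e ∧ ContMDiff I I n e.symm := by
  let _ := transportChartedSpace (H := H) e
  have key : ∀ x : M', extChartAt I x = e.toEquiv.toPartialEquiv.trans (extChartAt I (e x)) := by
    intro x
    exact PartialEquiv.trans_assoc e.toEquiv.toPartialEquiv (chartAt H (e x)).toPartialEquiv
      I.toPartialEquiv
  constructor
  · intro x
    rw [contMDiffAt_iff]
    refine ⟨e.continuous.continuousAt, ?_⟩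
    have : ContDiffWithinAt ℝ n id (Set.range I) (extChartAt I x x) := contDiffWithinAt_id
    refine this.congr_of_eventuallyEq ?_ ?_
    · filter_upwards [extChartAt_target_mem_nhdsWithin x] with y hy
      have h2 := (extChartAt I x).right_inv hy
      exact h2
    · exact (extChartAt I x).right_inv (mem_extChartAt_target x)
  · intro y
    rw [contMDiffAt_iff]
    refine ⟨e.symm.continuous.continuousAt, ?_⟩
    have : ContDiffWithinAt ℝ n id (Set.range I) (extChartAt I y y) := contDiffWithinAt_id
    have hk : extChartAt I (e.symm y) = e.toEquiv.toPartialEquiv.trans (extChartAt I y) := by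
      rw [key]; simp
    rw [hk]
    refine this.congr_of_eventuallyEq ?_ ?_
    · filter_upwards [extChartAt_target_mem_nhdsWithin y] with z hz
      have h2 := (extChartAt I y).right_inv hz
      simpa using h2
    · simp

theorem mfderiv_comp_of_eq {E'' H'' M'' : Type*} [NormedAddCommGroup E''] [NormedSpace ℝ E'']
    [TopologicalSpace H''] {I'' : ModelWithCorners ℝ E'' H''}
    [TopologicalSpace M''] [ChartedSpace H'' M'']
    {f : M → M'} {g : M' → M''} {x : M} {y : M'} (hy : f x = y)
    (hg : MDifferentiableAt I' I'' g y) (hf : MDifferentiableAt I I' f x) (v : E) :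
    (mfderiv I I'' (fun t => g (f t)) x : E →L[ℝ] E'') v =
      (mfderiv I' I'' g y : E' →L[ℝ] E'') ((mfderiv I I' f x : E →L[ℝ] E') v) := by
  subst hy
  exact DFunLike.congr_fun (mfderiv_comp x hg hf) v

end Forms

/-! ### Lie groups -/

section LieGroups

variable {E : Type*} [NormedAddCommGroup E] [NormedSpace ℝ E]
  {G : Type*} [TopologicalSpace G] [ChartedSpace E G] [Group G]

variable (E G) in
/-- The Lie algebra of a Lie group, as a vector space: the tangent space at `1`. -/
abbrev LieAlg : Type _ := GroupLieAlgebra 𝓘(ℝ, E) G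

variable (E) in
/-- The (left) Maurer-Cartan form `μ_g(v) = (L_{g⁻¹})_* v`; note `g⁻¹ * g = 1`. -/
def maurerCartan : OneForm 𝓘(ℝ, E) G (LieAlg E G) :=
  fun g => (mfderiv 𝓘(ℝ, E) 𝓘(ℝ, E) (fun h : G => g⁻¹ * h) g : _ →L[ℝ] LieAlg E G)

variable (E) in
/-- The adjoint action `Ad_g`, the differential at `1` of `h ↦ g h g⁻¹`; note `g 1 g⁻¹ = 1`. -/
def Ad (g : G) : LieAlg E G →L[ℝ] LieAlg E G :=
  (mfderiv 𝓘(ℝ, E) 𝓘(ℝ, E) (fun h : G => g * h * g⁻¹) 1 : LieAlg E G →L[ℝ] _)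

end LieGroups

/-! ### Principal bundles -/

section Principal

variable (EG EB EX : Type*)
  [NormedAddCommGroup EG] [NormedSpace ℝ EG]
  [NormedAddCommGroup EB] [NormedSpace ℝ EB]
  [NormedAddCommGroup EX] [NormedSpace ℝ EX]
  {G B X : Type*}
  [TopologicalSpace G] [ChartedSpace EG G] [Group G]
  [TopologicalSpace B] [ChartedSpace EB B]
  [TopologicalSpace X] [ChartedSpace EX X]

/-- `proj : B → X` together with the right action `act` of `G` on `B` is a smooth principal
`G`-bundle: near each point of `X` there is a smooth equivariant local trivialization. -/
structure IsPrincipal (proj : B → X) (act : B → G → B) : Prop where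
  act_one : ∀ b, act b 1 = b
  act_mul : ∀ b g h, act b (g * h) = act (act b g) h
  contMDiff_act : ContMDiff (𝓘(ℝ, EB).prod 𝓘(ℝ, EG)) 𝓘(ℝ, EB) ∞ (fun p : B × G => act p.1 p.2)
  contMDiff_proj : ContMDiff 𝓘(ℝ, EB) 𝓘(ℝ, EX) ∞ proj
  proj_act : ∀ b g, proj (act b g) = proj b
  exists_trivialization : ∀ x : X, ∃ e : Bundle.Trivialization G proj, x ∈ e.baseSet ∧
    ContMDiffOn 𝓘(ℝ, EB) (𝓘(ℝ, EX).prod 𝓘(ℝ, EG)) ∞ e e.source ∧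
    ContMDiffOn (𝓘(ℝ, EX).prod 𝓘(ℝ, EG)) 𝓘(ℝ, EB) ∞ e.toOpenPartialHomeomorph.symm e.target ∧
    ∀ b ∈ e.source, ∀ g : G, (e (act b g)).2 = (e b).2 * g

variable (G B X) in
/-- Smooth principal `G`-bundles with total space `B` and base `X`. -/
structure PrincipalBundle where
  proj : B → X
  act : B → G → B
  isPrincipal : IsPrincipal EG EB EX proj act

end Principal

section FiberSquare

variable {EG EB EX : Type*}
  [NormedAddCommGroup EG] [NormedSpace ℝ EG]
  [NormedAddCommGroup EB] [NormedSpace ℝ EB]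
  [NormedAddCommGroup EX] [NormedSpace ℝ EX]
  {G B X : Type*}
  [TopologicalSpace G] [ChartedSpace EG G] [Group G]
  [TopologicalSpace B] [ChartedSpace EB B]
  [TopologicalSpace X] [ChartedSpace EX X]

theorem IsPrincipal.existsUnique_div {proj : B → X} {act : B → G → B}
    (h : IsPrincipal EG EB EX proj act) (b₁ b₂ : B) (hb : proj b₁ = proj b₂) :
    ∃! g : G, act b₁ g = b₂ := by
  obtain ⟨e, hx, -, -, hact⟩ := h.exists_trivialization (proj b₁)
  have h1 : b₁ ∈ e.source := e.mem_source.2 hx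
  have h2 : b₂ ∈ e.source := e.mem_source.2 (hb ▸ hx)
  have hs : ∀ g, act b₁ g ∈ e.source := fun g => e.mem_source.2 (by rw [h.proj_act]; exact hx)
  refine ⟨(e b₁).2⁻¹ * (e b₂).2, ?_, ?_⟩
  · refine e.injOn (hs _) h2 (Prod.ext ?_ ?_)
    · exact (e.coe_fst (hs _)).trans ((h.proj_act _ _).trans (hb.trans (e.coe_fst h2).symm))
    · exact (hact _ h1 _).trans (mul_inv_cancel_left _ _)
  · intro g hg
    have := hact _ h1 g
    rw [hg] at this
    rw [this]; group

namespace PrincipalBundle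

variable (P : PrincipalBundle EG EB EX G B X)

/-- The fiber product `B^{[2]} = {(b₁, b₂) | π b₁ = π b₂}`. -/
def FiberSq : Type _ := {p : B × B // P.proj p.1 = P.proj p.2}

instance : TopologicalSpace P.FiberSq := inferInstanceAs (TopologicalSpace {p : B × B // P.proj p.1 = P.proj p.2})

/-- The projection `B^{[2]} → B`, `(b₁, b₂) ↦ b₁`. -/
def fst (p : P.FiberSq) : B := p.1.1

/-- The projection `B^{[2]} → B`, `(b₁, b₂) ↦ b₂`. -/
def snd (p : P.FiberSq) : B := p.1.2

/-- The map `ζ : B^{[2]} → G` determined by `b₁ ζ(b₁, b₂) = b₂`. -/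
def zeta (p : P.FiberSq) : G := (P.isPrincipal.existsUnique_div p.1.1 p.1.2 p.2).choose

theorem act_zeta (p : P.FiberSq) : P.act (P.fst p) (P.zeta p) = P.snd p :=
  (P.isPrincipal.existsUnique_div p.1.1 p.1.2 p.2).choose_spec.1

theorem zeta_eq {p : P.FiberSq} {g : G} (h : P.act (P.fst p) g = P.snd p) : P.zeta p = g :=
  ((P.isPrincipal.existsUnique_div p.1.1 p.1.2 p.2).choose_spec.2 g h).symm

theorem continuous_zeta [LieGroup 𝓘(ℝ, EG) ∞ G] : Continuous P.zeta := by
  have := topologicalGroup_of_lieGroup 𝓘(ℝ, EG) (G := G) ∞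
  rw [continuous_iff_continuousAt]
  intro p
  obtain ⟨e, hx, -, -, hact⟩ := P.isPrincipal.exists_trivialization (P.proj (P.fst p))
  have c1 : Continuous P.fst := continuous_fst.comp continuous_subtype_val
  have c2 : Continuous P.snd := continuous_snd.comp continuous_subtype_val
  have h1 : P.fst p ∈ e.source := e.mem_source.2 hx
  have h2 : P.snd p ∈ e.source := e.mem_source.2 (p.2 ▸ hx)
  have key : (fun r => (e (P.fst r)).2⁻¹ * (e (P.snd r)).2) =ᶠ[nhds p] P.zeta := by
    filter_upwards [c1.continuousAt.preimage_mem_nhds (e.open_source.mem_nhds h1)] with r hr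
    rw [← P.act_zeta r, hact _ hr]; group
  refine ContinuousAt.congr ?_ key
  exact ((continuous_snd.continuousAt.comp
      ((e.continuousOn_toFun.continuousAt (e.open_source.mem_nhds h1)).comp
        c1.continuousAt)).inv).mul
    (continuous_snd.continuousAt.comp
      (ContinuousAt.comp (x := p) (f := P.snd)
        (e.continuousOn_toFun.continuousAt (e.open_source.mem_nhds h2)) c2.continuousAt))

theorem continuous_act : Continuous (fun p : B × G => P.act p.1 p.2) :=
  P.isPrincipal.contMDiff_act.continuous

/-- The homeomorphism `B^{[2]} ≃ B × G`, `(b₁, b₂) ↦ (b₁, ζ(b₁, b₂))`. -/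
def fiberSqHomeomorph [LieGroup 𝓘(ℝ, EG) ∞ G] : P.FiberSq ≃ₜ B × G where
  toFun p := (P.fst p, P.zeta p)
  invFun r := ⟨(r.1, P.act r.1 r.2), (P.isPrincipal.proj_act r.1 r.2).symm⟩
  left_inv p := Subtype.ext (Prod.ext rfl (P.act_zeta p))
  right_inv _ := Prod.ext rfl (P.zeta_eq rfl)
  continuous_toFun := (continuous_fst.comp continuous_subtype_val).prodMk P.continuous_zeta
  continuous_invFun := Continuous.subtype_mk (continuous_fst.prodMk P.continuous_act) _

/-- The smooth structure of `B^{[2]}` as a submanifold of `B × B`, parametrized by the smooth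
embedding `B × G → B × B`, `(b, g) ↦ (b, b g)`, with image `B^{[2]}`. -/
instance [LieGroup 𝓘(ℝ, EG) ∞ G] : ChartedSpace (ModelProd EB EG) P.FiberSq :=
  transportChartedSpace P.fiberSqHomeomorph

instance [LieGroup 𝓘(ℝ, EG) ∞ G] [IsManifold 𝓘(ℝ, EB) ∞ B] :
    IsManifold (𝓘(ℝ, EB).prod 𝓘(ℝ, EG)) ∞ P.FiberSq :=
  isManifold_transport _ ∞ P.fiberSqHomeomorph

/-- The fundamental vector field `X^*` at `b`: the differential at `1` of `g ↦ b g`. -/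
def fundamental (b : B) : LieAlg EG G →L[ℝ] TangentSpace 𝓘(ℝ, EB) b :=
  (mfderiv 𝓘(ℝ, EG) 𝓘(ℝ, EB) (fun g : G => P.act b g) 1 : LieAlg EG G →L[ℝ] _)

/-- A (smooth, `Lie G`-valued) connection 1-form on a principal `G`-bundle. -/
structure Connection [IsManifold 𝓘(ℝ, EB) ∞ B] where
  form : OneForm 𝓘(ℝ, EB) B (LieAlg EG G)
  smooth : ContMDiff 𝓘(ℝ, EB).tangent 𝓘(ℝ, EG) ∞
    (fun v : TangentBundle 𝓘(ℝ, EB) B => (show EG from form v.proj v.snd))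
  fundamental : ∀ (b : B) (Y : LieAlg EG G), form b (P.fundamental b Y) = Y
  equivariant : ∀ g : G,
    OneForm.pullback 𝓘(ℝ, EB) 𝓘(ℝ, EB) (fun b => P.act b g) form =
      fun b => (Ad EG g⁻¹).comp (form b)

end PrincipalBundle

end FiberSquare

/-! ### Central extensions -/

section CentralExt

/-- A central extension `1 → 𝕋 → Γ̂ → Γ → 1` of Lie groups by the unit circle: an exact
sequence of smooth homomorphisms with central kernel, such that `Γ̂ → Γ` is a smooth
principal `𝕋`-bundle. -/
structure CentralExtension (E Eh : Type*)
    [NormedAddCommGroup E] [NormedSpace ℝ E] [NormedAddCommGroup Eh] [NormedSpace ℝ Eh]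
    (Γ Γh : Type*) [TopologicalSpace Γ] [ChartedSpace E Γ] [Group Γ]
    [TopologicalSpace Γh] [ChartedSpace Eh Γh] [Group Γh] where
  q : Γh →* Γ
  incl : Circle →* Γh
  contMDiff_q : ContMDiff 𝓘(ℝ, Eh) 𝓘(ℝ, E) ∞ q
  contMDiff_incl : ContMDiff (𝓡 1) 𝓘(ℝ, Eh) ∞ incl
  incl_injective : Function.Injective incl
  range_incl : incl.range = q.ker
  q_surjective : Function.Surjective q
  central : ∀ u g, incl u * g = g * incl u
  isPrincipal : IsPrincipal (EuclideanSpace ℝ (Fin 1)) Eh E q (fun g u => g * incl u)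

variable {E Eh : Type*}
  [NormedAddCommGroup E] [NormedSpace ℝ E] [NormedAddCommGroup Eh] [NormedSpace ℝ Eh]
  {Γ Γh : Type*} [TopologicalSpace Γ] [ChartedSpace E Γ] [Group Γ]
  [TopologicalSpace Γh] [ChartedSpace Eh Γh] [Group Γh]

namespace CentralExtension

variable (C : CentralExtension E Eh Γ Γh)

/-- The Lie algebra map `q_* : Lie Γ̂ → Lie Γ`; note `q 1 = 1`. -/
def qLie : LieAlg Eh Γh →L[ℝ] LieAlg E Γ :=
  (mfderiv 𝓘(ℝ, Eh) 𝓘(ℝ, E) C.q 1 : LieAlg Eh Γh →L[ℝ] _)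

/-- The Lie algebra map `iℝ → Lie Γ̂` induced by `𝕋 → Γ̂`, where `i t ∈ iℝ` is the velocity at
`s = 0` of the curve `s ↦ exp(i s t)` in `𝕋`. -/
def inclLie : ImagLine →L[ℝ] LieAlg Eh Γh :=
  (mfderiv 𝓘(ℝ, ℝ) 𝓘(ℝ, Eh) (fun t : ℝ => C.incl (Circle.exp t)) 0 :
    ℝ →L[ℝ] LieAlg Eh Γh).comp (Complex.imCLM.comp ImagLine.subtypeL)

theorem hasDeriv_coe_exp (c : ℂ) :
    mfderiv 𝓘(ℝ, ℝ) 𝓘(ℝ, ℂ) (fun t : ℝ => c * (Circle.exp t : ℂ)) 0 (1 : ℝ) =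
      c * Complex.I := by
  have h : HasDerivAt (fun t : ℝ => c * (Circle.exp t : ℂ)) (c * Complex.I) 0 := by
    have h1 : HasDerivAt (fun t : ℝ => Complex.exp (t * Complex.I)) Complex.I 0 := by
      have := ((Complex.ofRealCLM.hasDerivAt (x := (0 : ℝ))).mul_const Complex.I).cexp
      simpa using this
    simpa [Circle.coe_exp] using h1.const_mul c
  rw [mfderiv_eq_fderiv]
  exact (congrArg (fun L : ℝ →L[ℝ] ℂ => L 1) h.hasFDerivAt.fderiv).trans (by simp)

theorem mdiff_circle_coe : MDifferentiable (𝓡 1) 𝓘(ℝ, ℂ) (fun u : Circle => (u : ℂ)) := by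
  have : Fact (Module.finrank ℝ ℂ = 1 + 1) := finrank_real_complex_fact'
  exact (contMDiff_coe_sphere (E := ℂ) (n := 1) (m := 1)).mdifferentiable one_ne_zero

theorem mdiff_circle_exp : MDifferentiable 𝓘(ℝ, ℝ) (𝓡 1) Circle.exp :=
  (contMDiff_circleExp (m := 1)).mdifferentiable one_ne_zero

theorem mdiff_incl : MDifferentiable (𝓡 1) 𝓘(ℝ, Eh) C.incl :=
  C.contMDiff_incl.mdifferentiable (by simp)

theorem mdiff_q : MDifferentiable 𝓘(ℝ, Eh) 𝓘(ℝ, E) C.q :=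
  C.contMDiff_q.mdifferentiable (by simp)

theorem q_incl (u : Circle) : C.q (C.incl u) = 1 := by
  have : C.incl u ∈ C.q.ker := C.range_incl ▸ ⟨u, rfl⟩
  exact this


theorem mdiff_incl_exp :
    MDifferentiable 𝓘(ℝ, ℝ) 𝓘(ℝ, Eh) (fun t : ℝ => C.incl (Circle.exp t)) :=
  C.mdiff_incl.comp mdiff_circle_exp

theorem inclLie_apply (z : ImagLine) : C.inclLie z =
    (mfderiv 𝓘(ℝ, ℝ) 𝓘(ℝ, Eh) (fun t : ℝ => C.incl (Circle.exp t)) 0 : ℝ →L[ℝ] Eh)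
      (z : ℂ).im := rfl

theorem incl_exp_zero : C.incl (Circle.exp 0) = 1 := by simp

theorem qLie_inclLie (z : ImagLine) : C.qLie (C.inclLie z) = 0 := by
  have h := mfderiv_comp_of_eq (I := 𝓘(ℝ, ℝ)) (I' := 𝓘(ℝ, Eh)) (I'' := 𝓘(ℝ, E))
    (f := fun t : ℝ => C.incl (Circle.exp t)) (g := C.q) (x := 0) C.incl_exp_zero
    (C.mdiff_q 1) (C.mdiff_incl_exp 0) (z : ℂ).im
  rw [C.inclLie_apply]
  refine Eq.trans h.symm ?_
  have hfun : (fun t : ℝ => C.q (C.incl (Circle.exp t))) = fun _ => 1 := by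
    funext t; exact C.q_incl _
  exact (congrArg (fun f : ℝ → Γ => (mfderiv 𝓘(ℝ, ℝ) 𝓘(ℝ, E) f 0 : ℝ →L[ℝ] E) (z : ℂ).im)
    hfun).trans (DFunLike.congr_fun (mfderiv_const (I := 𝓘(ℝ, ℝ)) (I' := 𝓘(ℝ, E))) _)

theorem mdiff_circle_mul_left (u : Circle) :
    MDifferentiable (𝓡 1) (𝓡 1) (fun w : Circle => u * w) :=
  (contMDiff_mul_left (I := 𝓡 1) (n := 1) (a := u)).mdifferentiable one_ne_zero

/-- A smooth trivialization of `Γ̂ → Γ` over a neighbourhood of `1`. -/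
theorem exists_triv_one : ∃ e : Bundle.Trivialization Circle C.q, (1 : Γh) ∈ e.source ∧
    MDifferentiableAt 𝓘(ℝ, Eh) (𝓘(ℝ, E).prod (𝓡 1)) e 1 ∧
    MDifferentiableAt (𝓘(ℝ, E).prod (𝓡 1)) 𝓘(ℝ, Eh) e.toOpenPartialHomeomorph.symm (e 1) ∧
    ∀ u : Circle, e (C.incl u) = (1, (e 1).2 * u) := by
  obtain ⟨e, hx, h1, h2, h3⟩ := C.isPrincipal.exists_trivialization 1
  have hs : (1 : Γh) ∈ e.source := e.mem_source.2 (by simpa using hx)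
  have ht : e 1 ∈ e.target := e.map_source hs
  refine ⟨e, hs, ?_, ?_, ?_⟩
  · exact ((h1 1 hs).contMDiffAt (e.open_source.mem_nhds hs)).mdifferentiableAt (by simp)
  · exact ((h2 _ ht).contMDiffAt (e.open_target.mem_nhds ht)).mdifferentiableAt (by simp)
  · intro u
    have hu : C.incl u ∈ e.source := e.mem_source.2 (by rw [C.q_incl]; exact hx)
    refine Prod.ext ((e.coe_fst hu).trans (C.q_incl u)) ?_
    simpa using h3 1 hs u

theorem inclLie_injective : Function.Injective C.inclLie := by
  rw [injective_iff_map_eq_zero]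
  intro z hz
  obtain ⟨e, hs, he, -, h3⟩ := C.exists_triv_one
  have hsnd : MDifferentiableAt 𝓘(ℝ, Eh) (𝓡 1) (fun g => (e g).2) 1 :=
    MDifferentiableAt.comp (1 : Γh) mdifferentiableAt_snd he
  have hg : MDifferentiableAt 𝓘(ℝ, Eh) 𝓘(ℝ, ℂ) (fun g => ((e g).2 : ℂ)) 1 :=
    MDifferentiableAt.comp (1 : Γh) (mdiff_circle_coe _) hsnd
  have h := mfderiv_comp_of_eq (I := 𝓘(ℝ, ℝ)) (I' := 𝓘(ℝ, Eh)) (I'' := 𝓘(ℝ, ℂ))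
    (f := fun t : ℝ => C.incl (Circle.exp t)) (g := fun g => ((e g).2 : ℂ)) (x := 0)
    C.incl_exp_zero hg (C.mdiff_incl_exp 0) (z : ℂ).im
  rw [C.inclLie_apply] at hz
  have hz' := h.trans ((congrArg _ hz).trans (map_zero _))
  have hfun : (fun t : ℝ => ((e (C.incl (Circle.exp t))).2 : ℂ)) =
      fun t : ℝ => ((e 1).2 : ℂ) * (Circle.exp t : ℂ) := by
    funext t; rw [h3]; rfl
  have hz1 := (congrArg (fun f : ℝ → ℂ =>
    (mfderiv 𝓘(ℝ, ℝ) 𝓘(ℝ, ℂ) f 0 : ℝ →L[ℝ] ℂ) (z : ℂ).im) hfun).symm.trans hz'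
  have hlin : ∀ L : ℝ →L[ℝ] ℂ, ∀ r : ℝ, r • L 1 = L r := fun L r => by
    rw [← map_smul, smul_eq_mul, mul_one]
  have hd := hasDeriv_coe_exp ((e 1).2 : ℂ)
  have hz2 := (congrArg (fun w : ℂ => (z : ℂ).im • w) hd).symm.trans
    ((hlin _ _).trans hz1)
  have him : (z : ℂ).im = 0 := by
    have := smul_eq_zero.1 hz2
    rcases this with h | h
    · exact h
    · exact absurd h (mul_ne_zero (Circle.coe_ne_zero _) Complex.I_ne_zero)
  exact Subtype.ext (Complex.ext z.2 him)

theorem circle_tangent (w : EuclideanSpace ℝ (Fin 1)) : ∃ r : ℝ,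
    (mfderiv 𝓘(ℝ, ℝ) (𝓡 1) Circle.exp 0 : ℝ →L[ℝ] EuclideanSpace ℝ (Fin 1)) r = w := by
  have hne : (mfderiv 𝓘(ℝ, ℝ) (𝓡 1) Circle.exp 0 : ℝ →L[ℝ] EuclideanSpace ℝ (Fin 1)) 1 ≠ 0 := by
    intro h0
    have h := mfderiv_comp_of_eq (I := 𝓘(ℝ, ℝ)) (I' := 𝓡 1) (I'' := 𝓘(ℝ, ℂ))
      (f := fun t : ℝ => Circle.exp t) (g := fun u : Circle => (u : ℂ)) (x := 0) rfl
      (mdiff_circle_coe _) (mdiff_circle_exp 0) 1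
    have h' := h.trans ((congrArg _ h0).trans (map_zero _))
    have hd := hasDeriv_coe_exp 1
    have hfun : (fun t : ℝ => (1 : ℂ) * (Circle.exp t : ℂ)) = fun t => (Circle.exp t : ℂ) := by
      funext t; exact one_mul _
    have hd' := (congrArg (fun f : ℝ → ℂ =>
      (mfderiv 𝓘(ℝ, ℝ) 𝓘(ℝ, ℂ) f 0 : ℝ →L[ℝ] ℂ) 1) hfun).symm.trans hd
    exact Complex.I_ne_zero ((one_mul _).symm.trans (hd'.symm.trans h'))
  obtain ⟨c, hc⟩ := exists_smul_eq_of_finrank_eq_one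
    (finrank_euclideanSpace_fin (𝕜 := ℝ) (n := 1)) hne w
  have hlin : ∀ L : ℝ →L[ℝ] EuclideanSpace ℝ (Fin 1), ∀ r : ℝ, r • L 1 = L r := fun L r => by
    rw [← map_smul, smul_eq_mul, mul_one]
  exact ⟨c, (hlin _ c).symm.trans hc⟩

theorem exists_inclLie_eq (v : LieAlg Eh Γh) (hv : C.qLie v = 0) : ∃ z, C.inclLie z = v := by
  obtain ⟨e, hs, he, he', h3⟩ := C.exists_triv_one
  have he1 : e 1 = (1, (e 1).2) := by simpa using h3 1
  -- the differential of the trivialization maps `v` to a vertical vector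
  have hq : (mfderiv 𝓘(ℝ, Eh) (𝓘(ℝ, E).prod (𝓡 1)) e 1 :
      Eh →L[ℝ] E × EuclideanSpace ℝ (Fin 1)) v = (0, ((mfderiv 𝓘(ℝ, Eh) (𝓘(ℝ, E).prod (𝓡 1)) e 1 :
      Eh →L[ℝ] E × EuclideanSpace ℝ (Fin 1)) v).2) := by
    refine Prod.ext ?_ rfl
    have h := mfderiv_comp_of_eq (I := 𝓘(ℝ, Eh)) (I' := 𝓘(ℝ, E).prod (𝓡 1)) (I'' := 𝓘(ℝ, E))
      (f := e) (g := Prod.fst) (x := (1 : Γh)) rfl mdifferentiableAt_fst he v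
    have hfst : (mfderiv (𝓘(ℝ, E).prod (𝓡 1)) 𝓘(ℝ, E) Prod.fst (e 1) :
        E × EuclideanSpace ℝ (Fin 1) →L[ℝ] E) =
        ContinuousLinearMap.fst ℝ E (EuclideanSpace ℝ (Fin 1)) := mfderiv_fst
    have hev : (fun g => (e g).1) =ᶠ[nhds (1 : Γh)] C.q := by
      filter_upwards [e.open_source.mem_nhds hs] with g hg using e.coe_fst hg
    have h4 : (mfderiv 𝓘(ℝ, Eh) 𝓘(ℝ, E) (fun g => (e g).1) 1 : Eh →L[ℝ] E) v = 0 :=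
      (DFunLike.congr_fun (show (mfderiv 𝓘(ℝ, Eh) 𝓘(ℝ, E) (fun g => (e g).1) 1 : Eh →L[ℝ] E) =
        mfderiv 𝓘(ℝ, Eh) 𝓘(ℝ, E) C.q 1 from hev.mfderiv_eq) v).trans hv
    exact (DFunLike.congr_fun hfst _).symm.trans (h.symm.trans h4)
  generalize ((mfderiv 𝓘(ℝ, Eh) (𝓘(ℝ, E).prod (𝓡 1)) e 1 :
      Eh →L[ℝ] E × EuclideanSpace ℝ (Fin 1)) v).2 = w at hq
  -- `v` is the image of that vertical vector under the inverse of the trivialization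
  have hv1 : (mfderiv (𝓘(ℝ, E).prod (𝓡 1)) 𝓘(ℝ, Eh) e.toOpenPartialHomeomorph.symm (e 1) :
      E × EuclideanSpace ℝ (Fin 1) →L[ℝ] Eh) (0, w) = v := by
    have h := mfderiv_comp_of_eq (I := 𝓘(ℝ, Eh)) (I' := 𝓘(ℝ, E).prod (𝓡 1)) (I'' := 𝓘(ℝ, Eh))
      (f := e) (g := e.toOpenPartialHomeomorph.symm) (x := (1 : Γh)) rfl he' he v
    have hev : (fun g => e.toOpenPartialHomeomorph.symm (e g)) =ᶠ[nhds (1 : Γh)] id := by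
      filter_upwards [e.open_source.mem_nhds hs] with g hg using e.left_inv hg
    have h4 : (mfderiv 𝓘(ℝ, Eh) 𝓘(ℝ, Eh) (fun g => e.toOpenPartialHomeomorph.symm (e g)) 1 :
        Eh →L[ℝ] Eh) v = v :=
      (DFunLike.congr_fun (show (mfderiv 𝓘(ℝ, Eh) 𝓘(ℝ, Eh)
        (fun g => e.toOpenPartialHomeomorph.symm (e g)) 1 : Eh →L[ℝ] Eh) =
          mfderiv 𝓘(ℝ, Eh) 𝓘(ℝ, Eh) id 1 from hev.mfderiv_eq) v).trans
        (DFunLike.congr_fun (mfderiv_id (I := 𝓘(ℝ, Eh)) (x := (1 : Γh))) v)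
    exact (congrArg _ hq).symm.trans (h.symm.trans h4)
  -- on the fibre over `1` this inverse is a left translate of the inclusion of the circle
  have hfun : (fun u : Circle => e.toOpenPartialHomeomorph.symm ((1 : Γ), u)) =
      fun u => C.incl ((e 1).2⁻¹ * u) := by
    funext u
    have hu : C.incl ((e 1).2⁻¹ * u) ∈ e.source := e.mem_source.2 (by
      rw [C.q_incl]; simpa using e.mem_source.1 hs)
    have h := h3 ((e 1).2⁻¹ * u)
    rw [mul_inv_cancel_left] at h
    rw [← h]
    exact e.left_inv hu
  have hk : MDifferentiableAt (𝓡 1) (𝓘(ℝ, E).prod (𝓡 1)) (fun u : Circle => ((1 : Γ), u))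
      (e 1).2 := mdifferentiableAt_const.prodMk mdifferentiableAt_id
  have hk' : (mfderiv (𝓡 1) (𝓘(ℝ, E).prod (𝓡 1)) (fun u : Circle => ((1 : Γ), u)) (e 1).2 :
      EuclideanSpace ℝ (Fin 1) →L[ℝ] E × EuclideanSpace ℝ (Fin 1)) w = (0, w) := by
    have h : (mfderiv (𝓡 1) (𝓘(ℝ, E).prod (𝓡 1)) (fun u : Circle => ((1 : Γ), u)) (e 1).2 :
        EuclideanSpace ℝ (Fin 1) →L[ℝ] E × EuclideanSpace ℝ (Fin 1)) =
          ContinuousLinearMap.inr ℝ _ _ := mfderiv_prod_right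
    exact (DFunLike.congr_fun h w).trans rfl
  have h5 := mfderiv_comp_of_eq (I := 𝓡 1) (I' := 𝓘(ℝ, E).prod (𝓡 1)) (I'' := 𝓘(ℝ, Eh))
    (f := fun u : Circle => ((1 : Γ), u)) (g := e.toOpenPartialHomeomorph.symm)
    (x := (e 1).2) he1.symm he' hk w
  have h6 := h5.symm.trans (congrArg (fun f : Circle → Γh =>
    (mfderiv (𝓡 1) 𝓘(ℝ, Eh) f (e 1).2 : EuclideanSpace ℝ (Fin 1) →L[ℝ] Eh) w) hfun)
  have h7 := ((congrArg _ hk').trans hv1).symm.trans h6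
  have h8 := mfderiv_comp_of_eq (I := 𝓡 1) (I' := 𝓡 1) (I'' := 𝓘(ℝ, Eh))
    (f := fun u : Circle => (e 1).2⁻¹ * u) (g := C.incl) (x := (e 1).2) (inv_mul_cancel _)
    (C.mdiff_incl 1) (mdiff_circle_mul_left _ _) w
  obtain ⟨r, hr⟩ := circle_tangent ((mfderiv (𝓡 1) (𝓡 1) (fun u : Circle => (e 1).2⁻¹ * u)
    (e 1).2 : EuclideanSpace ℝ (Fin 1) →L[ℝ] EuclideanSpace ℝ (Fin 1)) w)
  have h9 := mfderiv_comp_of_eq (I := 𝓘(ℝ, ℝ)) (I' := 𝓡 1) (I'' := 𝓘(ℝ, Eh))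
    (f := fun t : ℝ => Circle.exp t) (g := C.incl) (x := 0) Circle.exp_zero
    (C.mdiff_incl 1) (mdiff_circle_exp 0) r
  refine ⟨⟨r * Complex.I, by simp⟩, ?_⟩
  rw [C.inclLie_apply]
  have him : ((r : ℂ) * Complex.I).im = r := by simp
  refine (congrArg _ him).trans (h9.trans ?_)
  exact (congrArg _ hr).trans (h8.symm.trans h7.symm)

/-- Exactness of `0 → iℝ → Lie Γ̂ → Lie Γ`: the map `iℝ → Lie Γ̂` identifies `iℝ` with the kernel
of `q_*`. -/
def centralEquiv : ImagLine ≃L[ℝ] LinearMap.ker (C.qLie : LieAlg Eh Γh →ₗ[ℝ] LieAlg E Γ) :=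
  have : T2Space (LieAlg Eh Γh) := inferInstanceAs (T2Space Eh)
  (LinearEquiv.ofBijective
    ((C.inclLie : ImagLine →ₗ[ℝ] LieAlg Eh Γh).codRestrict
      (LinearMap.ker (C.qLie : LieAlg Eh Γh →ₗ[ℝ] LieAlg E Γ)) C.qLie_inclLie)
    ⟨fun _ _ h => C.inclLie_injective (congrArg Subtype.val h), fun v => by
      obtain ⟨z, hz⟩ := C.exists_inclLie_eq v.1 v.2
      exact ⟨z, Subtype.ext hz⟩⟩).toContinuousLinearEquiv

/-- A linear map into `Lie Γ̂` with values in the kernel of `q_*`, regarded as an `iℝ`-valued map. -/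
def toImag {V : Type*} [AddCommGroup V] [Module ℝ V] [TopologicalSpace V]
    (f : V →L[ℝ] LieAlg Eh Γh) (hf : ∀ v, C.qLie (f v) = 0) : V →L[ℝ] ImagLine :=
  (C.centralEquiv.symm : _ →L[ℝ] ImagLine).comp
    (f.codRestrict (LinearMap.ker (C.qLie : LieAlg Eh Γh →ₗ[ℝ] LieAlg E Γ)) hf)

theorem inclLie_toImag {V : Type*} [AddCommGroup V] [Module ℝ V] [TopologicalSpace V]
    (f : V →L[ℝ] LieAlg Eh Γh) (hf : ∀ v, C.qLie (f v) = 0) (v : V) :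
    C.inclLie (C.toImag f hf v) = f v :=
  congrArg Subtype.val (C.centralEquiv.apply_symm_apply ⟨f v, hf v⟩)

/-- A split `σ : Lie Γ → Lie Γ̂`, as vector spaces, of `0 → iℝ → Lie Γ̂ → Lie Γ → 0`. -/
structure Split where
  toLin : LieAlg E Γ →L[ℝ] LieAlg Eh Γh
  qLie_toLin : ∀ Y, C.qLie (toLin Y) = Y

variable {C} in
/-- The difference `σ' - σ` of two splits, regarded as a linear map `Lie Γ → iℝ`. -/
def Split.diff (σ' σ : C.Split) : LieAlg E Γ →L[ℝ] ImagLine :=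
  C.toImag (σ'.toLin - σ.toLin) fun Y => by
    rw [sub_apply, map_sub, σ'.qLie_toLin, σ.qLie_toLin, sub_self]

/-- The action `Ad_γ : Lie Γ̂ → Lie Γ̂` of `γ ∈ Γ`, namely `Ad_γ̂` for a lift `γ̂ ∈ Γ̂` of `γ`. -/
def adLift (γ : Γ) : LieAlg Eh Γh →L[ℝ] LieAlg Eh Γh :=
  Ad Eh (Function.surjInv C.q_surjective γ)

theorem adLift_q (g : Γh) : C.adLift (C.q g) = Ad Eh g := by
  obtain ⟨u, hu⟩ : ∃ u, C.incl u = g⁻¹ * Function.surjInv C.q_surjective (C.q g) := by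
    have : g⁻¹ * Function.surjInv C.q_surjective (C.q g) ∈ C.q.ker := by
      rw [MonoidHom.mem_ker, map_mul, map_inv, Function.surjInv_eq C.q_surjective, inv_mul_cancel]
    rwa [← C.range_incl] at this
  have hs : Function.surjInv C.q_surjective (C.q g) = g * C.incl u := by rw [hu]; group
  have hfun : (fun h : Γh => g * C.incl u * h * (g * C.incl u)⁻¹) = fun h => g * h * g⁻¹ := by
    funext h
    rw [mul_assoc g, C.central u h]; group
  rw [adLift, hs]
  exact congrArg (fun f : Γh → Γh =>
    (show Eh →L[ℝ] Eh from mfderiv 𝓘(ℝ, Eh) 𝓘(ℝ, Eh) f 1)) hfun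

variable [LieGroup 𝓘(ℝ, E) ∞ Γ] [LieGroup 𝓘(ℝ, Eh) ∞ Γh]

theorem qLie_maurerCartan (g : Γh) (v : TangentSpace 𝓘(ℝ, Eh) g) :
    C.qLie (maurerCartan Eh g v) =
      OneForm.pullback 𝓘(ℝ, E) 𝓘(ℝ, Eh) C.q (maurerCartan E) g v := by
  have h1 := mfderiv_comp_of_eq (I := 𝓘(ℝ, Eh)) (I' := 𝓘(ℝ, Eh)) (I'' := 𝓘(ℝ, E))
    (f := fun h : Γh => g⁻¹ * h) (g := C.q) (x := g) (inv_mul_cancel g) (C.mdiff_q 1)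
    ((contMDiff_mul_left (I := 𝓘(ℝ, Eh)) (n := ∞)).mdifferentiable (by simp) g) v
  have h2 := mfderiv_comp_of_eq (I := 𝓘(ℝ, Eh)) (I' := 𝓘(ℝ, E)) (I'' := 𝓘(ℝ, E))
    (f := C.q) (g := fun h : Γ => (C.q g)⁻¹ * h) (x := g) rfl
    ((contMDiff_mul_left (I := 𝓘(ℝ, E)) (n := ∞)).mdifferentiable (by simp) _) (C.mdiff_q g) v
  have hfun : (fun h : Γh => C.q (g⁻¹ * h)) = fun h => (C.q g)⁻¹ * C.q h := by
    funext h; simp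
  exact h1.symm.trans ((congrArg (fun f : Γh → Γ =>
    (mfderiv 𝓘(ℝ, Eh) 𝓘(ℝ, E) f g : Eh →L[ℝ] E) v) hfun).trans h2)

theorem qLie_Ad (g : Γh) (Y : LieAlg Eh Γh) :
    C.qLie (Ad Eh g Y) = Ad E (C.q g) (C.qLie Y) := by
  have hc : ContMDiff 𝓘(ℝ, Eh) 𝓘(ℝ, Eh) ∞ (fun h : Γh => g * h * g⁻¹) :=
    (contMDiff_mul_right (a := g⁻¹)).comp (contMDiff_mul_left (a := g))
  have hc' : ContMDiff 𝓘(ℝ, E) 𝓘(ℝ, E) ∞ (fun h : Γ => C.q g * h * (C.q g)⁻¹) :=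
    (contMDiff_mul_right (a := (C.q g)⁻¹)).comp (contMDiff_mul_left (a := C.q g))
  have h1 := mfderiv_comp_of_eq (I := 𝓘(ℝ, Eh)) (I' := 𝓘(ℝ, Eh)) (I'' := 𝓘(ℝ, E))
    (f := fun h : Γh => g * h * g⁻¹) (g := C.q) (x := 1) (by simp) (C.mdiff_q 1)
    (hc.mdifferentiable (by simp) 1) Y
  have h2 := mfderiv_comp_of_eq (I := 𝓘(ℝ, Eh)) (I' := 𝓘(ℝ, E)) (I'' := 𝓘(ℝ, E))
    (f := C.q) (g := fun h : Γ => C.q g * h * (C.q g)⁻¹) (x := 1) (map_one C.q)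
    (hc'.mdifferentiable (by simp) 1) (C.mdiff_q 1) Y
  have hfun : (fun h : Γh => C.q (g * h * g⁻¹)) = fun h => C.q g * C.q h * (C.q g)⁻¹ := by
    funext h; simp
  exact h1.symm.trans ((congrArg (fun f : Γh → Γ =>
    (mfderiv 𝓘(ℝ, Eh) 𝓘(ℝ, E) f 1 : Eh →L[ℝ] E) Y) hfun).trans h2)

/-- The connection `ν_σ = μ̂ - σ(q^*μ)` on the `𝕋`-bundle `q : Γ̂ → Γ`, an `iℝ`-valued 1-form. -/
def nu (σ : C.Split) : OneForm 𝓘(ℝ, Eh) Γh ImagLine := fun g =>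
  C.toImag (maurerCartan Eh g -
      σ.toLin.comp (OneForm.pullback 𝓘(ℝ, E) 𝓘(ℝ, Eh) C.q (maurerCartan E) g)) fun v => by
    rw [sub_apply, map_sub, ContinuousLinearMap.comp_apply, σ.qLie_toLin,
      C.qLie_maurerCartan, sub_self]

/-- The group cocycle `Z_σ(γ, X) = Ad_γ σ(X) - σ(Ad_γ X) ∈ iℝ`. -/
def groupCocycle (σ : C.Split) (γ : Γ) : LieAlg E Γ →L[ℝ] ImagLine :=
  C.toImag ((C.adLift γ).comp σ.toLin - σ.toLin.comp (Ad E γ)) fun Y => by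
    rw [sub_apply, map_sub, ContinuousLinearMap.comp_apply,
      ContinuousLinearMap.comp_apply, σ.qLie_toLin, adLift, C.qLie_Ad, σ.qLie_toLin,
      Function.surjInv_eq C.q_surjective, sub_self]

end CentralExtension

end CentralExt

/-! ### The lifting bundle gerbe -/

section Gerbe

variable {E Eh EB EX : Type*}
  [NormedAddCommGroup E] [NormedSpace ℝ E] [NormedAddCommGroup Eh] [NormedSpace ℝ Eh]
  [NormedAddCommGroup EB] [NormedSpace ℝ EB] [NormedAddCommGroup EX] [NormedSpace ℝ EX]
  {Γ Γh B X : Type*}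
  [TopologicalSpace Γ] [ChartedSpace E Γ] [Group Γ]
  [TopologicalSpace Γh] [ChartedSpace Eh Γh] [Group Γh]
  [TopologicalSpace B] [ChartedSpace EB B]
  [TopologicalSpace X] [ChartedSpace EX X]
  (P : PrincipalBundle E EB EX Γ B X) (C : CentralExtension E Eh Γ Γh)

/-- The total space `J_B = ζ^*Γ̂ ⊆ B^{[2]} × Γ̂` of the lifting bundle gerbe: the pull-back of
`q : Γ̂ → Γ` along `ζ : B^{[2]} → Γ`. -/
def Gerbe : Type _ := {p : P.FiberSq × Γh // P.zeta p.1 = C.q p.2}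

namespace Gerbe

instance : TopologicalSpace (Gerbe P C) :=
  inferInstanceAs (TopologicalSpace {p : P.FiberSq × Γh // P.zeta p.1 = C.q p.2})

/-- The projection `ρ : J_B → B^{[2]}`. -/
def rho (p : Gerbe P C) : P.FiberSq := p.1.1

/-- The bundle map `J_B = ζ^*Γ̂ → Γ̂` covering `ζ`. -/
def zetaHat (p : Gerbe P C) : Γh := p.1.2

/-- The homeomorphism `J_B ≃ B × Γ̂`, `((b₁, b₂), γ̂) ↦ (b₁, γ̂)`. -/
def homeomorph : Gerbe P C ≃ₜ B × Γh where
  toFun p := (P.fst (rho P C p), zetaHat P C p)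
  invFun r := ⟨(⟨(r.1, P.act r.1 (C.q r.2)), (P.isPrincipal.proj_act _ _).symm⟩, r.2),
    P.zeta_eq rfl⟩
  left_inv p := by
    have h := P.act_zeta (rho P C p)
    rw [show P.zeta (rho P C p) = C.q (zetaHat P C p) from p.2] at h
    exact Subtype.ext (Prod.ext (Subtype.ext (Prod.ext rfl h)) rfl)
  right_inv _ := rfl
  continuous_toFun := by
    have h : Continuous (Subtype.val : Gerbe P C → P.FiberSq × Γh) := continuous_induced_dom
    exact (continuous_fst.comp (continuous_subtype_val.comp (continuous_fst.comp h))).prodMk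
      (continuous_snd.comp h)
  continuous_invFun := Continuous.subtype_mk ((Continuous.subtype_mk (continuous_fst.prodMk
    (P.continuous_act.comp (continuous_fst.prodMk
      (C.contMDiff_q.continuous.comp continuous_snd)))) _).prodMk continuous_snd) _

/-- The smooth structure of `J_B` as a submanifold of `B^{[2]} × Γ̂`, parametrized by the smooth
embedding `B × Γ̂ → B^{[2]} × Γ̂`, `(b, γ̂) ↦ ((b, b q(γ̂)), γ̂)`, with image `J_B`. -/
instance : ChartedSpace (ModelProd EB Eh) (Gerbe P C) :=
  transportChartedSpace (homeomorph P C)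

instance [IsManifold 𝓘(ℝ, EB) ∞ B] [LieGroup 𝓘(ℝ, Eh) ∞ Γh] :
    IsManifold (𝓘(ℝ, EB).prod 𝓘(ℝ, Eh)) ∞ (Gerbe P C) :=
  isManifold_transport _ ∞ (homeomorph P C)

variable [LieGroup 𝓘(ℝ, E) ∞ Γ] [LieGroup 𝓘(ℝ, Eh) ∞ Γh] [IsManifold 𝓘(ℝ, EB) ∞ B]

/-- The 1-form `∇_{θ,σ} = ζ^*ν_σ + ρ^* Z_σ(ζ⁻¹, π₁^*θ)` on `J_B`. -/
def connection (θ : P.Connection) (σ : C.Split) :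
    OneForm (𝓘(ℝ, EB).prod 𝓘(ℝ, Eh)) (Gerbe P C) ImagLine :=
  OneForm.pullback 𝓘(ℝ, Eh) (𝓘(ℝ, EB).prod 𝓘(ℝ, Eh)) (zetaHat P C) (C.nu σ) +
    OneForm.pullback (𝓘(ℝ, EB).prod 𝓘(ℝ, E)) (𝓘(ℝ, EB).prod 𝓘(ℝ, Eh)) (rho P C)
      (fun p => (C.groupCocycle σ (P.zeta p)⁻¹).comp
        (OneForm.pullback 𝓘(ℝ, EB) (𝓘(ℝ, EB).prod 𝓘(ℝ, E)) P.fst θ.form p))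

end Gerbe

end Gerbe

end LiftingGerbe

end

/-! Write `δ = σ' - σ : Lie Γ → iℝ`. The form `μ̂` does not involve the split, so `ν_σ' - ν_σ =
-δ(q^*μ)` (`nu_sub_nu`). The difference of the cocycles at `(γ, Y)` is `Ad_γ δ(Y) - δ(Ad_γ Y)`.
Since `iℝ` comes from the central circle, `Ad_γ` fixes it (`Ad_inclLie`), and this equals `δ(Y) -
δ(Ad_γ Y)` (`groupCocycle_sub_groupCocycle`).

On `J_B` the square `q ∘ ζ = ζ ∘ ρ` turns the pull-back of `q^*μ` into `ρ^* ζ^*μ`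
(`pullback_maurerCartan`). With `γ = ζ⁻¹` and `Y = π₁^*θ`, the difference of the two forms is
therefore `ρ^*(δ(π₁^*θ) - δ(Ad_{ζ⁻¹} π₁^*θ + ζ^*μ))`.

The bracket under the second `δ` is `π₂^*θ`: this is the gauge transformation rule for a connection,
obtained by differentiating `π₂ = π₁ · ζ` (`Connection.pullback_snd`). It uses both axioms of a
connection form, equivariance for motion of the point and normalization on fundamental vectors for
motion of the group element. -/

namespace LiftingGerbe

/-! ### Differentiability of translations and conjugations. -/

section LieGroups

variable {E : Type*} [NormedAddCommGroup E] [NormedSpace ℝ E]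
  {G : Type*} [TopologicalSpace G] [ChartedSpace E G] [Group G] [LieGroup 𝓘(ℝ, E) ∞ G]

theorem mdifferentiable_mul_left (g : G) :
    MDifferentiable 𝓘(ℝ, E) 𝓘(ℝ, E) (fun h : G => g * h) :=
  (contMDiff_mul_left (I := 𝓘(ℝ, E)) (n := ∞)).mdifferentiable (by simp)

theorem mdifferentiable_conj (g : G) :
    MDifferentiable 𝓘(ℝ, E) 𝓘(ℝ, E) (fun h : G => g * h * g⁻¹) :=
  ((contMDiff_mul_right (I := 𝓘(ℝ, E)) (n := ∞) (a := g⁻¹)).comp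
    (contMDiff_mul_left (a := g))).mdifferentiable (by simp)

end LieGroups

/-! ### Connection forms on the fibre product. -/

section Principal

variable {EG EB EX : Type*}
  [NormedAddCommGroup EG] [NormedSpace ℝ EG]
  [NormedAddCommGroup EB] [NormedSpace ℝ EB]
  [NormedAddCommGroup EX] [NormedSpace ℝ EX]
  {G B X : Type*}
  [TopologicalSpace G] [ChartedSpace EG G] [Group G]
  [TopologicalSpace B] [ChartedSpace EB B]
  [TopologicalSpace X] [ChartedSpace EX X]

namespace PrincipalBundle

variable (P : PrincipalBundle EG EB EX G B X)

theorem mdifferentiable_act :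
    MDifferentiable (𝓘(ℝ, EB).prod 𝓘(ℝ, EG)) 𝓘(ℝ, EB) (fun p : B × G => P.act p.1 p.2) :=
  P.isPrincipal.contMDiff_act.mdifferentiable (by simp)

theorem mdifferentiable_orbit (b : B) :
    MDifferentiable 𝓘(ℝ, EG) 𝓘(ℝ, EB) (fun g : G => P.act b g) := fun g =>
  (P.mdifferentiable_act (b, g)).comp g (mdifferentiableAt_const.prodMk mdifferentiableAt_id)

variable [LieGroup 𝓘(ℝ, EG) ∞ G]

/-- The velocity of an orbit map is a fundamental vector, given by the Maurer-Cartan form. -/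
theorem mfderiv_orbit (b : B) (g : G) (u : EG) :
    (mfderiv 𝓘(ℝ, EG) 𝓘(ℝ, EB) (fun h : G => P.act b h) g : EG →L[ℝ] EB) u =
      P.fundamental (P.act b g) (maurerCartan EG g u) := by
  -- Rebasing the orbit at `b g` makes it factor through `h ↦ g⁻¹ h`, which sends `g` to `1` and
  -- whose differential there is the Maurer-Cartan form.
  have h1 := mfderiv_comp_of_eq (I := 𝓘(ℝ, EG)) (I' := 𝓘(ℝ, EG)) (I'' := 𝓘(ℝ, EB))
    (f := fun h : G => g⁻¹ * h) (g := fun h : G => P.act (P.act b g) h) (x := g)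
    (inv_mul_cancel g) (P.mdifferentiable_orbit _ 1) (mdifferentiable_mul_left g⁻¹ g) u
  have hfun : (fun h : G => P.act (P.act b g) (g⁻¹ * h)) = fun h => P.act b h := by
    funext h
    rw [← P.isPrincipal.act_mul, mul_inv_cancel_left]
  exact (congrArg (fun f : G → B =>
    (mfderiv 𝓘(ℝ, EG) 𝓘(ℝ, EB) f g : EG →L[ℝ] EB) u) hfun).symm.trans h1

/-- The pull-back of a connection form along the action map `B × G → B`. -/
theorem Connection.form_mfderiv_act [IsManifold 𝓘(ℝ, EB) ∞ B] (θ : P.Connection)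
    (b : B) (g : G) (v : EB) (u : EG) :
    θ.form (P.act b g) ((mfderiv (𝓘(ℝ, EB).prod 𝓘(ℝ, EG)) 𝓘(ℝ, EB)
        (fun p : B × G => P.act p.1 p.2) (b, g) : EB × EG →L[ℝ] EB) (v, u)) =
      Ad EG g⁻¹ (θ.form b v) + maurerCartan EG g u := by
  -- The differential of the action is the sum of its partial differentials: equivariance of `θ`
  -- handles the one along `B`, and normalization on fundamental vectors the one along `G`.
  have h1 : (mfderiv (𝓘(ℝ, EB).prod 𝓘(ℝ, EG)) 𝓘(ℝ, EB)
        (fun p : B × G => P.act p.1 p.2) (b, g) : EB × EG →L[ℝ] EB) (v, u) =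
      (mfderiv 𝓘(ℝ, EB) 𝓘(ℝ, EB) (fun c : B => P.act c g) b : EB →L[ℝ] EB) v +
        (mfderiv 𝓘(ℝ, EG) 𝓘(ℝ, EB) (fun h : G => P.act b h) g : EG →L[ℝ] EB) u :=
    mfderiv_prod_eq_add_apply (P.mdifferentiable_act (b, g))
  refine (congrArg (θ.form (P.act b g)) h1).trans ((map_add _ _ _).trans ?_)
  have h2 := DFunLike.congr_fun (congrFun (θ.equivariant g) b) v
  have h3 := (congrArg (θ.form (P.act b g)) (P.mfderiv_orbit b g u)).trans
    (θ.fundamental (P.act b g) (maurerCartan EG g u))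
  exact congrArg₂ (· + ·) h2 h3

variable [IsManifold 𝓘(ℝ, EB) ∞ B]

/-- The smooth structure of `B^{[2]}` is transported along this homeomorphism, which is thus a
diffeomorphism by construction. Its two components are `π₁` and `ζ`, whence their smoothness. -/
theorem contMDiff_fiberSqHomeomorph :
    ContMDiff (𝓘(ℝ, EB).prod 𝓘(ℝ, EG)) (𝓘(ℝ, EB).prod 𝓘(ℝ, EG)) ∞ P.fiberSqHomeomorph :=
  (contMDiff_transport _ ∞ P.fiberSqHomeomorph).1

theorem contMDiff_fiberSqHomeomorph_symm :
    ContMDiff (𝓘(ℝ, EB).prod 𝓘(ℝ, EG)) (𝓘(ℝ, EB).prod 𝓘(ℝ, EG)) ∞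
      P.fiberSqHomeomorph.symm :=
  (contMDiff_transport _ ∞ P.fiberSqHomeomorph).2

theorem mdifferentiable_fst :
    MDifferentiable (𝓘(ℝ, EB).prod 𝓘(ℝ, EG)) 𝓘(ℝ, EB) P.fst :=
  (contMDiff_fst.comp P.contMDiff_fiberSqHomeomorph).mdifferentiable (by simp)

theorem mdifferentiable_zeta :
    MDifferentiable (𝓘(ℝ, EB).prod 𝓘(ℝ, EG)) 𝓘(ℝ, EG) P.zeta :=
  (contMDiff_snd.comp P.contMDiff_fiberSqHomeomorph).mdifferentiable (by simp)

/-- `π₂^*θ = Ad_{ζ⁻¹} π₁^*θ + ζ^*μ` on `B^{[2]}`. -/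
theorem Connection.pullback_snd (θ : P.Connection) (p : P.FiberSq) (w : EB × EG) :
    OneForm.pullback 𝓘(ℝ, EB) (𝓘(ℝ, EB).prod 𝓘(ℝ, EG)) P.snd θ.form p w =
      Ad EG (P.zeta p)⁻¹
        (OneForm.pullback 𝓘(ℝ, EB) (𝓘(ℝ, EB).prod 𝓘(ℝ, EG)) P.fst θ.form p w) +
      OneForm.pullback 𝓘(ℝ, EG) (𝓘(ℝ, EB).prod 𝓘(ℝ, EG)) P.zeta (maurerCartan EG) p w := by
  -- The second projection is the action composed with `(π₁, ζ)`, so the formula for `θ` along the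
  -- action map applies.
  have hfun : P.snd = fun p => P.act (P.fst p) (P.zeta p) := funext fun p => (P.act_zeta p).symm
  rw [hfun]
  have h1 := mfderiv_comp_of_eq (I := 𝓘(ℝ, EB).prod 𝓘(ℝ, EG)) (I' := 𝓘(ℝ, EB).prod 𝓘(ℝ, EG))
    (I'' := 𝓘(ℝ, EB)) (f := fun p => (P.fst p, P.zeta p))
    (g := fun r : B × G => P.act r.1 r.2) (x := p) rfl (P.mdifferentiable_act _)
    ((P.mdifferentiable_fst p).prodMk (P.mdifferentiable_zeta p)) w
  have h2 : (mfderiv (𝓘(ℝ, EB).prod 𝓘(ℝ, EG)) (𝓘(ℝ, EB).prod 𝓘(ℝ, EG))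
      (fun p => (P.fst p, P.zeta p)) p : EB × EG →L[ℝ] EB × EG) =
      (mfderiv (𝓘(ℝ, EB).prod 𝓘(ℝ, EG)) 𝓘(ℝ, EB) P.fst p : EB × EG →L[ℝ] EB).prod
        (mfderiv (𝓘(ℝ, EB).prod 𝓘(ℝ, EG)) 𝓘(ℝ, EG) P.zeta p : EB × EG →L[ℝ] EG) :=
    (P.mdifferentiable_fst p).mfderiv_prod (P.mdifferentiable_zeta p)
  have h3 := h1.trans (congrArg _ (DFunLike.congr_fun h2 w))
  exact (congrArg (θ.form (P.act (P.fst p) (P.zeta p))) h3).trans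
    (Connection.form_mfderiv_act P θ (P.fst p) (P.zeta p) _ _)

end PrincipalBundle

end Principal

/-! ### Dependence of `ν_σ` and `Z_σ` on the split. -/

namespace CentralExtension

variable {E Eh : Type*}
  [NormedAddCommGroup E] [NormedSpace ℝ E] [NormedAddCommGroup Eh] [NormedSpace ℝ Eh]
  {Γ Γh : Type*} [TopologicalSpace Γ] [ChartedSpace E Γ] [Group Γ]
  [TopologicalSpace Γh] [ChartedSpace Eh Γh] [Group Γh]
  (C : CentralExtension E Eh Γ Γh)

/-- Identities in `iℝ` are checked below after applying the injective map `inclLie`; there `toImag`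
disappears and ordinary algebra in `Lie Γ̂` remains. -/
theorem inclLie_diff (σ' σ : C.Split) (Y : LieAlg E Γ) :
    C.inclLie (σ'.diff σ Y) = σ'.toLin Y - σ.toLin Y :=
  C.inclLie_toImag _ _ Y

variable [LieGroup 𝓘(ℝ, Eh) ∞ Γh]

/-- The adjoint action is trivial on the central subalgebra `iℝ`. -/
theorem Ad_inclLie (g : Γh) (z : ImagLine) : Ad Eh g (C.inclLie z) = C.inclLie z := by
  rw [C.inclLie_apply]
  have h1 := mfderiv_comp_of_eq (I := 𝓘(ℝ, ℝ)) (I' := 𝓘(ℝ, Eh)) (I'' := 𝓘(ℝ, Eh))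
    (f := fun t : ℝ => C.incl (Circle.exp t)) (g := fun h : Γh => g * h * g⁻¹) (x := 0)
    C.incl_exp_zero (mdifferentiable_conj g 1) (C.mdiff_incl_exp 0) (z : ℂ).im
  -- By centrality, conjugation fixes every point of the curve whose velocity defines `inclLie`.
  have hfun : (fun t : ℝ => g * C.incl (Circle.exp t) * g⁻¹) =
      fun t => C.incl (Circle.exp t) := by
    funext t
    rw [← C.central, mul_inv_cancel_right]
  exact h1.symm.trans (congrArg (fun f : ℝ → Γh =>
    (mfderiv 𝓘(ℝ, ℝ) 𝓘(ℝ, Eh) f 0 : ℝ →L[ℝ] Eh) (z : ℂ).im) hfun)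

variable [LieGroup 𝓘(ℝ, E) ∞ Γ]

/-- The term `μ̂` is common to both connections and cancels. -/
theorem nu_sub_nu (σ' σ : C.Split) (g : Γh) (v : TangentSpace 𝓘(ℝ, Eh) g) :
    C.nu σ' g v - C.nu σ g v =
      -σ'.diff σ (OneForm.pullback 𝓘(ℝ, E) 𝓘(ℝ, Eh) C.q (maurerCartan E) g v) := by
  apply C.inclLie_injective
  rw [map_sub, map_neg, inclLie_diff, nu, nu, inclLie_toImag, inclLie_toImag]
  simp only [sub_apply, ContinuousLinearMap.comp_apply]
  abel

theorem groupCocycle_sub_groupCocycle (σ' σ : C.Split) (γ : Γ) (Y : LieAlg E Γ) :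
    C.groupCocycle σ' γ Y - C.groupCocycle σ γ Y =
      σ'.diff σ Y - σ'.diff σ (Ad E γ Y) := by
  apply C.inclLie_injective
  -- The difference of the two splits at `Y` is central, so the adjoint action leaves it unchanged.
  have h : C.adLift γ (σ'.toLin Y) - C.adLift γ (σ.toLin Y) = σ'.toLin Y - σ.toLin Y := by
    rw [← map_sub, ← inclLie_diff, adLift, Ad_inclLie]
  rw [map_sub, map_sub, inclLie_diff, inclLie_diff, ← h, groupCocycle, groupCocycle,
    inclLie_toImag, inclLie_toImag]
  simp only [sub_apply, ContinuousLinearMap.comp_apply]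
  abel

end CentralExtension

/-! ### Differentials of the structure maps of `J_B`. -/

section Gerbe

variable {E Eh EB EX : Type*}
  [NormedAddCommGroup E] [NormedSpace ℝ E] [NormedAddCommGroup Eh] [NormedSpace ℝ Eh]
  [NormedAddCommGroup EB] [NormedSpace ℝ EB] [NormedAddCommGroup EX] [NormedSpace ℝ EX]
  {Γ Γh B X : Type*}
  [TopologicalSpace Γ] [ChartedSpace E Γ] [Group Γ]
  [TopologicalSpace Γh] [ChartedSpace Eh Γh] [Group Γh]
  [TopologicalSpace B] [ChartedSpace EB B]
  [TopologicalSpace X] [ChartedSpace EX X]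
  (P : PrincipalBundle E EB EX Γ B X) (C : CentralExtension E Eh Γ Γh)
  [LieGroup 𝓘(ℝ, Eh) ∞ Γh] [IsManifold 𝓘(ℝ, EB) ∞ B]

namespace Gerbe

theorem contMDiff_homeomorph :
    ContMDiff (𝓘(ℝ, EB).prod 𝓘(ℝ, Eh)) (𝓘(ℝ, EB).prod 𝓘(ℝ, Eh)) ∞ (homeomorph P C) :=
  (contMDiff_transport _ ∞ (homeomorph P C)).1

theorem mdifferentiable_zetaHat :
    MDifferentiable (𝓘(ℝ, EB).prod 𝓘(ℝ, Eh)) 𝓘(ℝ, Eh) (zetaHat P C) :=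
  (contMDiff_snd.comp (contMDiff_homeomorph P C)).mdifferentiable (by simp)

variable [LieGroup 𝓘(ℝ, E) ∞ Γ]

theorem mdifferentiable_rho :
    MDifferentiable (𝓘(ℝ, EB).prod 𝓘(ℝ, Eh)) (𝓘(ℝ, EB).prod 𝓘(ℝ, E)) (rho P C) := by
  have h1 : ContMDiff (𝓘(ℝ, EB).prod 𝓘(ℝ, Eh)) (𝓘(ℝ, EB).prod 𝓘(ℝ, E)) ∞
      (fun x : Gerbe P C => ((homeomorph P C x).1, C.q (homeomorph P C x).2)) :=
    (contMDiff_fst.comp (contMDiff_homeomorph P C)).prodMk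
      (C.contMDiff_q.comp (contMDiff_snd.comp (contMDiff_homeomorph P C)))
  -- In the global parametrizations `J_B ≃ B × Γ̂` and `B^{[2]} ≃ B × Γ`, the map `ρ` is `id × q`;
  -- this is the condition defining the pull-back `ζ^*Γ̂`.
  have h2 : rho P C = fun x => P.fiberSqHomeomorph.symm
      ((homeomorph P C x).1, C.q (homeomorph P C x).2) := by
    funext x
    rw [eq_comm, Homeomorph.symm_apply_eq]
    exact Prod.ext rfl x.2.symm
  rw [h2]
  exact (P.contMDiff_fiberSqHomeomorph_symm.comp h1).mdifferentiable (by simp)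

/-- The square `q ∘ ζ = ζ ∘ ρ` on Maurer-Cartan forms. -/
theorem pullback_maurerCartan (x : Gerbe P C) (v : EB × Eh) :
    OneForm.pullback 𝓘(ℝ, E) 𝓘(ℝ, Eh) C.q (maurerCartan E) (zetaHat P C x)
        ((mfderiv (𝓘(ℝ, EB).prod 𝓘(ℝ, Eh)) 𝓘(ℝ, Eh) (zetaHat P C) x : EB × Eh →L[ℝ] Eh) v) =
      OneForm.pullback 𝓘(ℝ, E) (𝓘(ℝ, EB).prod 𝓘(ℝ, E)) P.zeta (maurerCartan E) (rho P C x)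
        ((mfderiv (𝓘(ℝ, EB).prod 𝓘(ℝ, Eh)) (𝓘(ℝ, EB).prod 𝓘(ℝ, E)) (rho P C) x :
          EB × Eh →L[ℝ] EB × E) v) := by
  have h1 := mfderiv_comp_of_eq (I := 𝓘(ℝ, EB).prod 𝓘(ℝ, Eh)) (I' := 𝓘(ℝ, Eh))
    (I'' := 𝓘(ℝ, E)) (f := zetaHat P C) (g := C.q) (x := x) rfl (C.mdiff_q _)
    (mdifferentiable_zetaHat P C x) v
  have h2 := mfderiv_comp_of_eq (I := 𝓘(ℝ, EB).prod 𝓘(ℝ, Eh)) (I' := 𝓘(ℝ, EB).prod 𝓘(ℝ, E))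
    (I'' := 𝓘(ℝ, E)) (f := rho P C) (g := P.zeta) (x := x) rfl (P.mdifferentiable_zeta _)
    (mdifferentiable_rho P C x) v
  have hfun : (fun x => C.q (zetaHat P C x)) = fun x => P.zeta (rho P C x) :=
    funext fun x => x.2.symm
  have h3 := h1.symm.trans ((congrArg (fun f : Gerbe P C → Γ =>
    (mfderiv (𝓘(ℝ, EB).prod 𝓘(ℝ, Eh)) 𝓘(ℝ, E) f x : EB × Eh →L[ℝ] E) v) hfun).trans h2)
  -- The base points `q(γ̂)` and `ζ(ρ x)` agree only propositionally. Every tangent space of `Γ`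
  -- unfolds to `E`, so viewing both forms as maps out of `E` allows them to be compared without
  -- transport.
  have h4 : (show E →L[ℝ] LieAlg E Γ from maurerCartan E (C.q (zetaHat P C x))) =
      (show E →L[ℝ] LieAlg E Γ from maurerCartan E (P.zeta (rho P C x))) :=
    congrArg (fun γ : Γ => (show E →L[ℝ] LieAlg E Γ from maurerCartan E γ)) x.2.symm
  exact congrArg₂ (fun (L : E →L[ℝ] LieAlg E Γ) (u : E) => L u) h4 h3

end Gerbe

end Gerbe

end LiftingGerbe

/-! ### Comparison of the two connections on `J_B`. -/

theorem mainTheorem9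
    {E Eh EB EX : Type*}
    [NormedAddCommGroup E] [NormedSpace ℝ E] [NormedAddCommGroup Eh] [NormedSpace ℝ Eh]
    [NormedAddCommGroup EB] [NormedSpace ℝ EB] [NormedAddCommGroup EX] [NormedSpace ℝ EX]
    {Γ Γh B X : Type*}
    [TopologicalSpace Γ] [ChartedSpace E Γ] [Group Γ] [LieGroup 𝓘(ℝ, E) ∞ Γ]
    [TopologicalSpace Γh] [ChartedSpace Eh Γh] [Group Γh] [LieGroup 𝓘(ℝ, Eh) ∞ Γh]
    [TopologicalSpace B] [ChartedSpace EB B] [IsManifold 𝓘(ℝ, EB) ∞ B]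
    [TopologicalSpace X] [ChartedSpace EX X] [IsManifold 𝓘(ℝ, EX) ∞ X]
    (C : LiftingGerbe.CentralExtension E Eh Γ Γh)
    (P : LiftingGerbe.PrincipalBundle E EB EX Γ B X)
    (θ : P.Connection) (σ σ' : C.Split) :
    LiftingGerbe.Gerbe.connection P C θ σ' - LiftingGerbe.Gerbe.connection P C θ σ =
      LiftingGerbe.OneForm.pullback (𝓘(ℝ, EB).prod 𝓘(ℝ, E)) (𝓘(ℝ, EB).prod 𝓘(ℝ, Eh))
        (LiftingGerbe.Gerbe.rho P C)
        (LiftingGerbe.OneForm.pullback 𝓘(ℝ, EB) (𝓘(ℝ, EB).prod 𝓘(ℝ, E)) P.fst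
            (fun b => (σ'.diff σ).comp (θ.form b)) -
          LiftingGerbe.OneForm.pullback 𝓘(ℝ, EB) (𝓘(ℝ, EB).prod 𝓘(ℝ, E)) P.snd
            (fun b => (σ'.diff σ).comp (θ.form b))) := by
  funext x
  refine ContinuousLinearMap.ext fun v => ?_
  set w := (mfderiv (𝓘(ℝ, EB).prod 𝓘(ℝ, Eh)) (𝓘(ℝ, EB).prod 𝓘(ℝ, E))
    (LiftingGerbe.Gerbe.rho P C) x : EB × Eh →L[ℝ] EB × E) v
  have h1 := C.nu_sub_nu σ' σ (LiftingGerbe.Gerbe.zetaHat P C x)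
    ((mfderiv (𝓘(ℝ, EB).prod 𝓘(ℝ, Eh)) 𝓘(ℝ, Eh) (LiftingGerbe.Gerbe.zetaHat P C) x :
      EB × Eh →L[ℝ] Eh) v)
  -- This expresses the `ν` contribution through `ζ^*μ` at `w = ρ_* v`, the vector at which the
  -- other terms are evaluated.
  rw [LiftingGerbe.Gerbe.pullback_maurerCartan P C x v] at h1
  have h2 := C.groupCocycle_sub_groupCocycle σ' σ (P.zeta (LiftingGerbe.Gerbe.rho P C x))⁻¹
    (LiftingGerbe.OneForm.pullback 𝓘(ℝ, EB) (𝓘(ℝ, EB).prod 𝓘(ℝ, E)) P.fst θ.form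
      (LiftingGerbe.Gerbe.rho P C x) w)
  have h3 := congrArg (σ'.diff σ) (LiftingGerbe.PrincipalBundle.Connection.pullback_snd P θ
    (LiftingGerbe.Gerbe.rho P C x) w)
  rw [map_add] at h3
  -- Regrouping as (difference of `ν`) + (difference of cocycles) leaves `-δ(ζ^*μ) + (δ(π₁^*θ) -
  -- δ(Ad_{ζ⁻¹} π₁^*θ))` at `w`, where `δ = σ' - σ`. Expanding `δ(π₂^*θ)` on the other side by `h3`
  -- makes the two sides agree up to rearrangement.
  refine (add_sub_add_comm _ _ _ _).trans ((congrArg₂ (· + ·) h1 h2).trans ?_)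
  refine Eq.trans ?_ (congrArg (σ'.diff σ (LiftingGerbe.OneForm.pullback 𝓘(ℝ, EB)
    (𝓘(ℝ, EB).prod 𝓘(ℝ, E)) P.fst θ.form (LiftingGerbe.Gerbe.rho P C x) w) - ·) h3.symm)
  abel
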